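/- A pre-C*-algebra is a unital complex $*$-algebra $A$ with a submultiplicative norm satisfying $\|x^*x\|=\|x\|^2$ (not necessarily complete; the zero algebra is allowed). A matrix $M\in M_n(A)$ is positive if $M=N^*N$ for some $N\in M_n(\overline A)$, where $\overline A$ is the completion of $A$. A linear map $\varphi\colon A\to B$ between pre-C*-algebras is completely positive unital (CPU) if $\varphi(1)=1$ and, for every $n$, applying $\varphi$ entrywise sends positive matrices in $M_n(A)$ to positive matrices in $M_n(B)$; it is deterministic if it is CPU and a $*$-homomorphism. The categories $\mathsf{pCPU}_{\min}$ and $\mathsf{pCPU}_{\max}$ both have pre-C*-algebras as objects and the formal opposites of CPU maps as morphisms, have the same deterministic morphisms, and in both the classical objects are the commutative pre-C*-algebras (the two differ only in their tensor product, which plays no role here). Let $A$ be a pre-C*-algebra. - A distribution object of $A$ is a pre-C*-algebra $PA$ with a CPU map $\mathrm{samp}_A\colon A\to PA$ such that for every pre-C*-algebra $B$ and every CPU map $\varphi\colon A\to B$ there is exactly one deterministic map $f\colon PA\to B$ with $f\circ\mathrm{samp}_A=\varphi$. - A state space object of $A$ is a commutative pre-C*-algebra $SA$ with a CPU map $\mathrm{ev}_A\colon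 A\to SA$ such that for every commutative pre-C*-algebra $B$ and every CPU map $\varphi\colon A\to B$ there is exactly one deterministic map $f\colon SA\to B$ with $f\circ\mathrm{ev}_A=\varphi$. **Corollary 4.13.** Every pre-C*-algebra $A$ has a distribution object and a state space object. For every distribution object $(PA,\mathrm{samp}_A)$ and every state space object $(SA,\mathrm{ev}_A)$ of $A$, the state space object $SA$ is the abelianization of $PA$: there is a deterministic map $\mathrm{ev}_A^\sharp\colon PA\to SA$ with $\mathrm{ev}_A^\sharp\circ\mathrm{samp}_A=\mathrm{ev}_A$, and, writing $I$ for the closed two-sided ideal of $PA$ generated by the commutators $xy-yx$, the map $\mathrm{ev}_A^\sharp$ is surjective, has kernel $I$, and satisfies $\|\mathrm{ev}_A^\sharp(x)\|=\inf_{y\in I}\|x-y\|$ for all $x\in PA$; that is, it induces an isometric $*$-isomorphism $PA/I\cong SA$. Moreover, for every commutative pre-C*-algebra $B$, composition with $\mathrm{ev}_A^\sharp$ is a bijection from the deterministic maps $SA\to B$ to the deterministic maps $PA\to B$. -/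

import Mathlib

open UniformSpace

universe u

/-- A pre-C*-algebra: a unital complex `*`-algebra with a submultiplicative norm satisfying the
C*-identity. The norm need not be complete, and the zero algebra is allowed. -/
class PreCStarAlgebra (A : Type*) extends NormedRing A, StarRing A, CStarRing A,
    NormedAlgebra ℂ A, StarModule ℂ A

namespace PreCStarAlgebra

section Completion

variable (A : Type*) [PreCStarAlgebra A]

/-- The star operation of the completion, extended by continuity from the (isometric) star. -/
noncomputable instance : Star (Completion A) := ⟨Completion.map star⟩

theorem coe_star (a : A) : ((star a : A) : Completion A) = star (a : Completion A) :=
  (Completion.map_coe (f := (star : A → A)) star_isometry.uniformContinuous a).symm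

theorem continuous_star_completion : Continuous (star : Completion A → Completion A) :=
  Completion.continuous_map

/-- The completion of a pre-C*-algebra is a C*-algebra. -/
noncomputable instance : CStarAlgebra (Completion A) where
  star_involutive x := by
    have hc := continuous_star_completion A
    induction x using Completion.induction_on with
    | hp => exact isClosed_eq (hc.comp hc) continuous_id
    | ih a => rw [← coe_star, ← coe_star, star_star]
  star_mul x y := by
    have hc := continuous_star_completion A
    induction x, y using Completion.induction_on₂ with
    | hp =>
      exact isClosed_eq (hc.comp continuous_mul)
        ((hc.comp continuous_snd).mul (hc.comp continuous_fst))
    | ih a b =>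
      rw [← Completion.coe_mul, ← coe_star, ← coe_star, ← coe_star, star_mul,
        Completion.coe_mul]
  star_add x y := by
    have hc := continuous_star_completion A
    induction x, y using Completion.induction_on₂ with
    | hp =>
      exact isClosed_eq (hc.comp continuous_add)
        ((hc.comp continuous_fst).add (hc.comp continuous_snd))
    | ih a b =>
      rw [← Completion.coe_add, ← coe_star, ← coe_star, ← coe_star, star_add,
        Completion.coe_add]
  norm_mul_self_le x := by
    have hc := continuous_star_completion A
    induction x using Completion.induction_on with
    | hp =>
      exact isClosed_le (continuous_norm.mul continuous_norm)
        (continuous_norm.comp (hc.mul continuous_id))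
    | ih a =>
      rw [← coe_star, ← Completion.coe_mul, Completion.norm_coe, Completion.norm_coe]
      exact CStarRing.norm_mul_self_le a
  norm_smul_le := norm_smul_le
  star_smul c x := by
    have hc := continuous_star_completion A
    induction x using Completion.induction_on with
    | hp => exact isClosed_eq (hc.comp (continuous_const_smul c)) (hc.const_smul (star c))
    | ih a => rw [← Completion.coe_smul, ← coe_star, ← coe_star, star_smul, Completion.coe_smul]

end Completion

/-- A matrix `M` over a pre-C*-algebra `A`, i.e. an element of `A ⊙ Mₙ`, is positive if
`M = N* N` for some `N` in the completion of `A ⊙ Mₙ`, which is the C*-algebra of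
`n × n` matrices over the completion of `A`. -/
def IsPositiveMatrix {A : Type*} [PreCStarAlgebra A] {n : ℕ}
    (M : CStarMatrix (Fin n) (Fin n) A) : Prop :=
  ∃ N : CStarMatrix (Fin n) (Fin n) (Completion A),
    M.map (fun a : A => (a : Completion A)) = star N * N

/-- Completely positive unital linear maps `A ⇝ B`. These are, as formal opposites, the
morphisms `B → A` of the category `pCPU` (with either the minimal or the maximal
tensor product; the tensor product is irrelevant for objects and morphisms). -/
structure IsCPU {A B : Type*} [PreCStarAlgebra A] [PreCStarAlgebra B] (φ : A →ₗ[ℂ] B) : Prop where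
  map_one : φ 1 = 1
  map_positive : ∀ (n : ℕ) (M : CStarMatrix (Fin n) (Fin n) A),
    IsPositiveMatrix M → IsPositiveMatrix (M.map φ)

/-- Completely positive unital maps that are `*`-homomorphisms, i.e. (the formal opposites of)
the deterministic morphisms of `pCPU`. -/
structure IsDeterministic {A B : Type*} [PreCStarAlgebra A] [PreCStarAlgebra B]
    (φ : A →ₗ[ℂ] B) : Prop extends IsCPU φ where
  map_mul : ∀ x y : A, φ (x * y) = φ x * φ y
  map_star : ∀ x : A, φ (star x) = star (φ x)

/-- Classical objects: commutative pre-C*-algebras. -/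
def IsClassical (B : Type*) [PreCStarAlgebra B] : Prop := ∀ x y : B, x * y = y * x

/-- `samp : A ⇝ P` makes `P` a distribution object of `A`: composition with `samp` is a bijection
from the deterministic maps `P ⇝ B` to the completely positive unital maps `A ⇝ B`, for
every pre-C*-algebra `B`. -/
structure IsDistributionObject {A P : Type u} [PreCStarAlgebra A] [PreCStarAlgebra P]
    (samp : A →ₗ[ℂ] P) : Prop where
  isCPU : IsCPU samp
  existsUnique : ∀ (B : Type u) [PreCStarAlgebra B] (φ : A →ₗ[ℂ] B), IsCPU φ →
    ∃! f : P →ₗ[ℂ] B, IsDeterministic f ∧ f ∘ₗ samp = φ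

/-- `ev : A ⇝ S` makes `S` a state space object of `A`: `S` is classical, and composition with `ev`
is a bijection from the deterministic maps `S ⇝ B` to the completely positive unital
maps `A ⇝ B`, for every classical `B`. -/
structure IsStateSpaceObject {A S : Type u} [PreCStarAlgebra A] [PreCStarAlgebra S]
    (ev : A →ₗ[ℂ] S) : Prop where
  isClassical : IsClassical S
  isCPU : IsCPU ev
  existsUnique : ∀ (B : Type u) [PreCStarAlgebra B], IsClassical B →
    ∀ φ : A →ₗ[ℂ] B, IsCPU φ → ∃! f : S →ₗ[ℂ] B, IsDeterministic f ∧ f ∘ₗ ev = φ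

/-- The closed two-sided ideal of `P` generated by the commutators. -/
def commutatorIdeal (P : Type*) [PreCStarAlgebra P] : Set P :=
  closure (TwoSidedIdeal.span {c : P | ∃ x y : P, c = x * y - y * x} : Set P)

/-- The `*`-homomorphism `q : P ⇝ S` is the abelianization of `P`: it induces an isometric
`*`-isomorphism from the quotient of `P` by the closed two-sided ideal generated by the
commutators, with its quotient norm, onto `S`. -/
structure IsAbelianization {P S : Type*} [PreCStarAlgebra P] [PreCStarAlgebra S]
    (q : P →ₗ[ℂ] S) : Prop where
  map_one : q 1 = 1
  map_mul : ∀ x y : P, q (x * y) = q x * q y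
  map_star : ∀ x : P, q (star x) = star (q x)
  surjective : Function.Surjective q
  ker_eq : ∀ x : P, q x = 0 ↔ x ∈ commutatorIdeal P
  norm_eq : ∀ x : P, ‖q x‖ = Metric.infDist x (commutatorIdeal P)

end PreCStarAlgebra

/-! Both universal objects come from one construction. Each CPU map `φ : A → B` extends to the free
algebra over `A` and gives a seminorm there. These seminorms form a set, so one CPU map can be
chosen for each. CPU maps are uniformly bounded, so together they map `A` into a bounded product,
and the image of the free algebra is the object sought. Every `φ` is dominated in norm by this
image, hence factors through it. The map from `A` is CPU because positivity is detected factor by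
factor: it means self-adjointness and a vanishing negative part, both of which are equations.
Restricting to commutative targets gives the state space.

For commutative `B`, deterministic maps out of `P` and out of `S` both correspond to CPU maps out of
`A`, so `S` is universal among commutative targets of `P`. If `P/I` is itself a pre-C*-algebra, it
is such a target, and comparing it with `S` gives contractions both ways. The C*-identity on `P/I`
is the analytic core (`infDist_sq_le`): without completeness, the cutoffs must be taken in the
completion (`exists_cutoff`) and then approximated from within the ideal. -/

namespace PreCStarAlgebra

/-! ### Positivity and completely positive unital maps -/

/-- A jointly injective family of `*`-homomorphisms between C*-algebras reflects positivity. -/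
theorem exists_eq_star_mul_self_of_forall_map {C : Type*} [CStarAlgebra C] {ι : Type*}
    {D : ι → Type*} [∀ i, CStarAlgebra (D i)] (π : ∀ i, C →⋆ₙₐ[ℂ] D i)
    (hinj : ∀ x, (∀ i, π i x = 0) → x = 0) {a : C} (ha : ∀ i, ∃ b, π i a = star b * b) :
    ∃ b, a = star b * b := by
  let _ : PartialOrder C := CStarAlgebra.spectralOrder _
  have _ : StarOrderedRing C := CStarAlgebra.spectralOrderedRing _
  let _ (i) : PartialOrder (D i) := CStarAlgebra.spectralOrder _
  have _ (i) : StarOrderedRing (D i) := CStarAlgebra.spectralOrderedRing _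
  simp_rw [← CStarAlgebra.nonneg_iff_eq_star_mul_self] at ha ⊢
  have hsa : IsSelfAdjoint a := by
    rw [isSelfAdjoint_iff, ← sub_eq_zero]
    refine hinj _ fun i => ?_
    rw [map_sub, map_star, (IsSelfAdjoint.of_nonneg (ha i)).star_eq, sub_self]
  -- The negative part is given by functional calculus, which commutes with each `π i`.
  refine CStarAlgebra.nonneg_iff_isSelfAdjoint_and_negPart_eq_zero.2 ⟨hsa, hinj _ fun i => ?_⟩
  have h := (CStarAlgebra.nonneg_iff_isSelfAdjoint_and_negPart_eq_zero.1 (ha i)).2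
  rw [CFC.negPart_def] at h ⊢
  rw [← h]
  exact NonUnitalStarAlgHomClass.map_cfcₙ ((π i).restrictScalars ℝ) _ a
    (hφ := map_continuous (π i))

section

variable {A B : Type*} [PreCStarAlgebra A] [PreCStarAlgebra B]

theorem exists_completion_extension (φ : A →⋆ₐ[ℂ] B) (hφ : ∀ x, ‖φ x‖ ≤ ‖x‖) :
    ∃ F : Completion A →⋆ₙₐ[ℂ] Completion B,
      ∀ a : A, F (a : Completion A) = (φ a : Completion B) := by
  have hc : Continuous φ := AddMonoidHomClass.continuous_of_bound φ 1 (by simpa using hφ)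
  let R := Completion.mapRingHom (φ : A →+* B) hc
  have hR : Continuous R := Completion.continuous_map
  have hcoe (a : A) : R (a : Completion A) = (φ a : Completion B) :=
    Completion.mapRingHom_coe hc a
  refine ⟨{ R with map_smul' := fun c x => ?_, map_zero' := map_zero R,
                    map_star' := fun x => ?_ }, hcoe⟩
  · change R (c • x) = c • R x
    induction x using Completion.induction_on with
    | hp => exact isClosed_eq (hR.comp (continuous_const_smul c)) (hR.const_smul c)
    | ih a => rw [← Completion.coe_smul, hcoe, hcoe, map_smul, Completion.coe_smul]
  · change R (star x) = star (R x)
    induction x using Completion.induction_on with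
    | hp => exact isClosed_eq (hR.comp continuous_star) hR.star
    | ih a => rw [← coe_star, hcoe, hcoe, map_star, coe_star]

/-- A contractive unital `*`-homomorphism is deterministic. -/
theorem isDeterministic_of_norm_le (φ : A →⋆ₐ[ℂ] B) (hφ : ∀ x, ‖φ x‖ ≤ ‖x‖) :
    IsDeterministic (φ : A →ₗ[ℂ] B) where
  map_one := map_one φ
  map_mul := map_mul φ
  map_star := map_star φ
  map_positive n M := by
    rintro ⟨N, hN⟩
    obtain ⟨F, hF⟩ := exists_completion_extension φ hφ
    refine ⟨CStarMatrix.mapₙₐ F N, ?_⟩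
    rw [← map_star, ← map_mul, ← hN]
    ext i j
    exact (hF _).symm

theorem IsCPU.comp {C : Type*} [PreCStarAlgebra C] {ψ : B →ₗ[ℂ] C} {φ : A →ₗ[ℂ] B}
    (hψ : IsCPU ψ) (hφ : IsCPU φ) : IsCPU (ψ ∘ₗ φ) where
  map_one := by simp [hφ.map_one, hψ.map_one]
  map_positive n M hM := hψ.map_positive n _ (hφ.map_positive n M hM)

theorem IsDeterministic.comp {C : Type*} [PreCStarAlgebra C] {ψ : B →ₗ[ℂ] C} {φ : A →ₗ[ℂ] B}
    (hψ : IsDeterministic ψ) (hφ : IsDeterministic φ) : IsDeterministic (ψ ∘ₗ φ) where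
  toIsCPU := hψ.toIsCPU.comp hφ.toIsCPU
  map_mul x y := by simp [hφ.map_mul, hψ.map_mul]
  map_star x := by simp [hφ.map_star, hψ.map_star]

/-- A family of contractive `*`-homomorphisms determining the norm reflects positivity of
matrices. -/
theorem isPositiveMatrix_of_forall {ι : Type*} {D : ι → Type*} [∀ i, PreCStarAlgebra (D i)]
    (π : ∀ i, A →⋆ₐ[ℂ] D i) (hle : ∀ i x, ‖π i x‖ ≤ ‖x‖)
    (hnorm : ∀ (x : A) (r : ℝ), 0 ≤ r → (∀ i, ‖π i x‖ ≤ r) → ‖x‖ ≤ r) {n : ℕ}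
    {M : CStarMatrix (Fin n) (Fin n) A} (hM : ∀ i, IsPositiveMatrix (M.map (π i))) :
    IsPositiveMatrix M := by
  choose F hF using fun i => exists_completion_extension (π i) (hle i)
  have hFle (i) (x : Completion A) : ‖F i x‖ ≤ ‖x‖ := NonUnitalStarAlgHom.norm_apply_le (F i) x
  have hinj (x : Completion A) (hx : ∀ i, F i x = 0) : x = 0 := by
    by_contra hne
    -- Injectivity on `A` need not pass to the completion, but norm control does: if `a` is within
    -- `‖x‖ / 3` of `x`, every `π i a` has norm at most `‖x‖ / 3`, hence so has `a`, and `‖x‖ ≤ 2‖x‖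
    -- / 3`.
    have hpos : 0 < ‖x‖ / 3 := by positivity
    obtain ⟨_, ⟨a, rfl⟩, hb⟩ := Metric.mem_closure_iff.1
      (Completion.denseRange_coe (α := A) x) (‖x‖ / 3) hpos
    rw [dist_eq_norm] at hb
    have ha : ‖a‖ ≤ ‖x‖ / 3 := hnorm a _ hpos.le fun i => by
      rw [← Completion.norm_coe (π i a), ← hF, ← norm_neg, ← zero_sub, ← hx i, ← map_sub]
      exact (hFle i _).trans hb.le
    have := norm_le_norm_sub_add x (a : Completion A)
    rw [Completion.norm_coe] at this
    linarith
  let _ : PartialOrder (Completion A) := CStarAlgebra.spectralOrder _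
  have _ : StarOrderedRing (Completion A) := CStarAlgebra.spectralOrderedRing _
  let _ (i) : PartialOrder (Completion (D i)) := CStarAlgebra.spectralOrder _
  have _ (i) : StarOrderedRing (Completion (D i)) := CStarAlgebra.spectralOrderedRing _
  refine exists_eq_star_mul_self_of_forall_map (fun i => CStarMatrix.mapₙₐ (F i))
    (fun N hN => ?_) fun i => ?_
  · ext j k
    exact hinj _ fun i => congrArg (fun L => L j k) (hN i)
  · obtain ⟨N, hN⟩ := hM i
    refine ⟨N, hN ▸ ?_⟩
    ext j k
    exact hF i _

/-- Positivity of an element, i.e. of a `1 × 1` matrix. -/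
theorem isPositiveMatrix_const_iff (a : A) :
    IsPositiveMatrix (CStarMatrix.ofMatrix (fun _ _ : Fin 1 => a)) ↔
      ∃ b : Completion A, (a : Completion A) = star b * b := by
  constructor
  · rintro ⟨N, hN⟩
    refine ⟨N 0 0, ?_⟩
    have := congrArg (fun L => L 0 0) hN
    rwa [CStarMatrix.mul_apply, Fin.sum_univ_one, CStarMatrix.star_apply] at this
  · rintro ⟨b, hb⟩
    refine ⟨CStarMatrix.ofMatrix (fun _ _ => b), ?_⟩
    ext i j
    rw [CStarMatrix.mul_apply, Fin.sum_univ_one, CStarMatrix.star_apply]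
    exact hb

theorem IsCPU.map_star_mul_self {φ : A →ₗ[ℂ] B} (hφ : IsCPU φ) {a : A}
    (ha : ∃ b : Completion A, (a : Completion A) = star b * b) :
    ∃ b : Completion B, (φ a : Completion B) = star b * b := by
  rw [← isPositiveMatrix_const_iff] at ha ⊢
  exact hφ.map_positive 1 _ ha

theorem coe_real_smul_one (r : ℝ) :
    (((r : ℂ) • (1 : A) : A) : Completion A) = algebraMap ℝ (Completion A) r := by
  rw [Completion.coe_smul, Algebra.algebraMap_eq_smul_one, Completion.coe_one, Complex.coe_smul]

/-- Positivity of `‖a‖ ± a` in the completion is preserved by `φ`, which bounds the spectrum of `φ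
a`. -/
theorem IsCPU.map_isSelfAdjoint {φ : A →ₗ[ℂ] B} (hφ : IsCPU φ) {a : A} (ha : IsSelfAdjoint a) :
    IsSelfAdjoint (φ a) ∧ ‖φ a‖ ≤ ‖a‖ := by
  let _ : PartialOrder (Completion A) := CStarAlgebra.spectralOrder _
  have _ : StarOrderedRing (Completion A) := CStarAlgebra.spectralOrderedRing _
  let _ : PartialOrder (Completion B) := CStarAlgebra.spectralOrder _
  have _ : StarOrderedRing (Completion B) := CStarAlgebra.spectralOrderedRing _
  have hpos {a : A} (h : 0 ≤ (a : Completion A)) : 0 ≤ (φ a : Completion B) :=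
    CStarAlgebra.nonneg_iff_eq_star_mul_self.2
      (hφ.map_star_mul_self (CStarAlgebra.nonneg_iff_eq_star_mul_self.1 h))
  have ha' : IsSelfAdjoint (a : Completion A) := by
    rw [isSelfAdjoint_iff, ← coe_star, ha.star_eq]
  have h₁ := hpos (a := ((‖a‖ : ℝ) : ℂ) • (1 : A) - a) <| by
    rw [Completion.coe_sub, coe_real_smul_one, ← Completion.norm_coe a, sub_nonneg]
    exact ha'.le_algebraMap_norm_self
  have h₂ := hpos (a := ((‖a‖ : ℝ) : ℂ) • (1 : A) + a) <| by
    rw [Completion.coe_add, coe_real_smul_one, ← Completion.norm_coe a, ← neg_le_iff_add_nonneg']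
    exact ha'.neg_algebraMap_norm_le_self
  rw [map_sub, map_smul, hφ.map_one, Completion.coe_sub, coe_real_smul_one] at h₁
  rw [map_add, map_smul, hφ.map_one, Completion.coe_add, coe_real_smul_one] at h₂
  have hsa : IsSelfAdjoint (φ a : Completion B) := by
    have := (IsSelfAdjoint.of_nonneg h₂).sub (IsSelfAdjoint.algebraMap (Completion B) (.all ‖a‖))
    simpa using this
  refine ⟨?_, ?_⟩
  · rw [isSelfAdjoint_iff] at hsa ⊢
    rw [← coe_star] at hsa
    exact Completion.coe_injective _ hsa
  · rw [← Completion.norm_coe (φ a)]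
    obtain _ | _ := subsingleton_or_nontrivial (Completion B)
    · rw [Subsingleton.elim (φ a : Completion B) 0, norm_zero]; positivity
    rw [sub_nonneg] at h₁
    rw [← neg_le_iff_add_nonneg', ← map_neg] at h₂
    obtain h | h := CStarAlgebra.norm_or_neg_norm_mem_spectrum hsa
    · exact (le_algebraMap_iff_spectrum_le (a := (φ a : Completion B))).1 h₁ _ h
    · linarith [(algebraMap_le_iff_le_spectrum (a := (φ a : Completion B))).1 h₂ _ h]

theorem IsCPU.map_star {φ : A →ₗ[ℂ] B} (hφ : IsCPU φ) (a : A) : φ (star a) = star (φ a) := by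
  have hre := (hφ.map_isSelfAdjoint (realPart a).2).1.star_eq
  have him := (hφ.map_isSelfAdjoint (imaginaryPart a).2).1.star_eq
  conv_lhs => rw [← realPart_add_I_smul_imaginaryPart a]
  conv_rhs => rw [← realPart_add_I_smul_imaginaryPart a]
  simp only [star_add, star_smul, map_add, map_smul, hre, him, selfAdjoint.star_val_eq]

/-- The 2 comes from splitting into real and imaginary parts; any uniform constant would serve to
make families of CPU maps bounded. -/
theorem IsCPU.norm_map_le {φ : A →ₗ[ℂ] B} (hφ : IsCPU φ) (a : A) : ‖φ a‖ ≤ 2 * ‖a‖ := by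
  have hre := (hφ.map_isSelfAdjoint (realPart a).2).2
  have him := (hφ.map_isSelfAdjoint (imaginaryPart a).2).2
  have h₁ : ‖(realPart a : A)‖ ≤ ‖a‖ := realPart.norm_le a
  have h₂ : ‖(imaginaryPart a : A)‖ ≤ ‖a‖ := imaginaryPart.norm_le a
  conv_lhs => rw [← realPart_add_I_smul_imaginaryPart a]
  rw [map_add, map_smul]
  refine (norm_add_le _ _).trans ?_
  rw [norm_smul, Complex.norm_I, one_mul]
  linarith

/-- The C*-identity reduces to the self-adjoint element `star a * a`, where the bound has constant
1. -/
theorem IsDeterministic.norm_map_le {φ : A →ₗ[ℂ] B} (hφ : IsDeterministic φ) (a : A) :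
    ‖φ a‖ ≤ ‖a‖ := by
  refine abs_le_of_sq_le_sq' ?_ (norm_nonneg a) |>.2
  rw [sq, sq, ← CStarRing.norm_star_mul_self, ← CStarRing.norm_star_mul_self, ← hφ.map_star,
    ← hφ.map_mul]
  exact (hφ.map_isSelfAdjoint (.star_mul_self a)).2

end

/-! ### The universal CPU map -/

open scoped ENNReal

noncomputable instance lpInfty {I : Type*} (B : I → Type*) [∀ i, PreCStarAlgebra (B i)]
    [∀ i, Nontrivial (B i)] : PreCStarAlgebra (lp B ∞) where
  toNormedRing := lp.inftyNormedRing
  toStarRing := lp.inftyStarRing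
  toCStarRing := lp.inftyCStarRing
  toNormedAlgebra := lp.inftyNormedAlgebra
  toStarModule := inferInstance

noncomputable instance starSubalgebra {D : Type*} [PreCStarAlgebra D] (S : StarSubalgebra ℂ D) :
    PreCStarAlgebra S where
  norm_mul_self_le x := CStarRing.norm_mul_self_le (x : D)
  norm_smul_le := norm_smul_le

/-- Evaluation of a bounded family at an index. -/
noncomputable def lpInftyEval {I : Type*} (B : I → Type*) [∀ i, PreCStarAlgebra (B i)]
    [∀ i, Nontrivial (B i)] (i : I) : lp B ∞ →⋆ₐ[ℂ] B i where
  toFun x := x i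
  map_one' := rfl
  map_mul' _ _ := rfl
  map_zero' := rfl
  map_add' _ _ := rfl
  commutes' _ := rfl
  map_star' _ := rfl

/-- The norm function on the free algebra over `A` induced by a linear map `A → B`. -/
noncomputable def freeNorm {A B : Type*} [PreCStarAlgebra A] [PreCStarAlgebra B] (φ : A →ₗ[ℂ] B) :
    FreeAlgebra ℂ A → ℝ :=
  fun t => ‖FreeAlgebra.lift ℂ φ t‖

/-- An algebra homomorphism which is dominated by a surjective one factors through it. -/
theorem exists_lift_of_norm_le {F P D : Type*} [Ring F] [Algebra ℂ F] [PreCStarAlgebra P]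
    [PreCStarAlgebra D] (R : F →ₐ[ℂ] P) (hR : Function.Surjective R) (ψ : F →ₐ[ℂ] D)
    (hle : ∀ t, ‖ψ t‖ ≤ ‖R t‖) : ∃ f : P →ₐ[ℂ] D, ∀ t, f (R t) = ψ t := by
  have hker (s t) (h : R s = R t) : ψ s = ψ t := by
    have := hle (s - t)
    rw [map_sub, map_sub, h, sub_self, norm_zero] at this
    exact sub_eq_zero.1 (norm_le_zero_iff.1 this)
  let f : P → D := fun x => ψ (hR x).choose
  have hf (t) : f (R t) = ψ t := hker _ _ (hR (R t)).choose_spec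
  have hfc (r : ℂ) : f (algebraMap ℂ P r) = algebraMap ℂ D r := by
    rw [← R.commutes, hf, AlgHom.commutes]
  have hfm (x y) : f (x * y) = f x * f y := by
    obtain ⟨s, rfl⟩ := hR x
    obtain ⟨t, rfl⟩ := hR y
    rw [← map_mul, hf, hf, hf, map_mul]
  have hfa (x y) : f (x + y) = f x + f y := by
    obtain ⟨s, rfl⟩ := hR x
    obtain ⟨t, rfl⟩ := hR y
    rw [← map_add, hf, hf, hf, map_add]
  exact ⟨{ toFun := f
           map_one' := by simpa using hfc 1
           map_zero' := by simpa using hfc 0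
           commutes' := hfc
           map_mul' := hfm
           map_add' := hfa }, hf⟩

/-- The norm functions on the free algebra over `A` induced by completely positive unital maps into
nontrivial pre-C*-algebras of the class `K`. -/
def freeNorms (A : Type u) [PreCStarAlgebra A] (K : ∀ B : Type u, [PreCStarAlgebra B] → Prop) :
    Set (FreeAlgebra ℂ A → ℝ) :=
  {N | ∃ (B : Type u) (_ : PreCStarAlgebra B) (φ : A →ₗ[ℂ] B),
    Nontrivial B ∧ K B ∧ IsCPU φ ∧ N = freeNorm φ}

/-- For every class `K` of pre-C*-algebras there is a completely positive unital map which is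
universal among those into members of `K`. -/
theorem exists_universal (A : Type u) [PreCStarAlgebra A]
    (K : ∀ B : Type u, [PreCStarAlgebra B] → Prop) :
    ∃ (P : Type u) (_ : PreCStarAlgebra P) (samp : A →ₗ[ℂ] P), IsCPU samp ∧
      (∀ (B : Type u) [PreCStarAlgebra B], K B → ∀ φ : A →ₗ[ℂ] B, IsCPU φ →
        ∃! f : P →ₗ[ℂ] B, IsDeterministic f ∧ f ∘ₗ samp = φ) ∧
      ((∀ (B : Type u) [PreCStarAlgebra B], K B → IsClassical B) → IsClassical P) := by
  -- Indexing by norm functions keeps the product in universe `u`.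
  choose B instB φ hnt hK hφ hN using fun N : freeNorms A K => N.2
  let samp₀ : A →ₗ[ℂ] lp B ∞ :=
    { toFun := fun a => ⟨fun i => φ i a, memℓp_infty ⟨2 * ‖a‖, by
        rintro _ ⟨i, rfl⟩
        exact (hφ i).norm_map_le a⟩⟩
      map_add' := fun a b => by ext i; exact map_add (φ i) a b
      map_smul' := fun c a => by ext i; exact map_smul (φ i) c a }
  have hone : samp₀ 1 = 1 := by ext i; exact (hφ i).map_one
  have hstar (a : A) : samp₀ (star a) = star (samp₀ a) := by ext i; exact (hφ i).map_star a
  let L : FreeAlgebra ℂ A →ₐ[ℂ] lp B ∞ := FreeAlgebra.lift ℂ samp₀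
  have hLι (a : A) : L (FreeAlgebra.ι ℂ a) = samp₀ a := FreeAlgebra.lift_ι_apply _ _
  have hstarL (t : FreeAlgebra ℂ A) : star (L t) ∈ L.range := by
    induction t using FreeAlgebra.induction with
    | grade0 r =>
      rw [AlgHom.commutes, ← algebraMap_star_comm]
      exact L.range.algebraMap_mem _
    | grade1 a => rw [hLι, ← hstar, ← hLι]; exact ⟨_, rfl⟩
    | mul a b ha hb => rw [map_mul, star_mul]; exact mul_mem hb ha
    | add a b ha hb => rw [map_add, star_add]; exact add_mem ha hb
  let P : StarSubalgebra ℂ (lp B ∞) :=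
    { L.range with star_mem' := by rintro _ ⟨t, rfl⟩; exact hstarL t }
  let samp : A →ₗ[ℂ] P :=
    { toFun := fun a => ⟨samp₀ a, FreeAlgebra.ι ℂ a, hLι a⟩
      map_add' := fun a b => Subtype.ext (map_add samp₀ a b)
      map_smul' := fun c a => Subtype.ext (map_smul samp₀ c a) }
  let R : FreeAlgebra ℂ A →ₐ[ℂ] P := FreeAlgebra.lift ℂ samp
  have hRι (a : A) : R (FreeAlgebra.ι ℂ a) = samp a := FreeAlgebra.lift_ι_apply _ _
  have hR (t) : (R t : lp B ∞) = L t := by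
    have : P.subtype.toAlgHom.comp R = L := by
      ext a
      simp [hRι, hLι, samp]
    exact DFunLike.congr_fun this t
  have hsurj : Function.Surjective R := by
    rintro ⟨_, t, rfl⟩
    exact ⟨t, Subtype.ext (hR t)⟩
  have hLi (t) (i) : (L t : ∀ i, B i) i = FreeAlgebra.lift ℂ (φ i) t := by
    have : (lpInftyEval B i).toAlgHom.comp L = FreeAlgebra.lift ℂ (φ i) := by
      ext a
      simp [hLι]
      rfl
    exact DFunLike.congr_fun this t
  refine ⟨P, inferInstance, samp, ⟨Subtype.ext hone, fun n M hM => ?_⟩, fun D _ hD ψ hψ => ?_,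
    fun hcl x y => ?_⟩
  · refine isPositiveMatrix_of_forall (fun i => (lpInftyEval B i).comp P.subtype)
      (fun i x => lp.norm_apply_le_norm ENNReal.top_ne_zero (x : lp B ∞) i)
      (fun x r hr h => lp.norm_le_of_forall_le hr h) fun i => ?_
    exact (hφ i).map_positive n M hM
  · have hle (t) : ‖FreeAlgebra.lift ℂ ψ t‖ ≤ ‖R t‖ := by
      -- Zero targets are not among the factors and are treated apart.
      obtain _ | _ := subsingleton_or_nontrivial D
      · rw [Subsingleton.elim (FreeAlgebra.lift ℂ ψ t) 0, norm_zero]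
        positivity
      -- `ψ` need not be a chosen representative, but some representative has the same norm
      -- function.
      let i : freeNorms A K := ⟨freeNorm ψ, D, _, ψ, inferInstance, hD, hψ, rfl⟩
      have h : freeNorm ψ t = freeNorm (φ i) t := congrFun (hN i) t
      change freeNorm ψ t ≤ ‖(R t : lp B ∞)‖
      rw [h, freeNorm, ← hLi, hR]
      exact lp.norm_apply_le_norm ENNReal.top_ne_zero (L t) i
    obtain ⟨f, hf⟩ := exists_lift_of_norm_le R hsurj (FreeAlgebra.lift ℂ ψ) hle
    have hfs (a : A) : f (samp a) = ψ a := by rw [← hRι, hf, FreeAlgebra.lift_ι_apply]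
    have hsstar (a : A) : samp (star a) = star (samp a) := Subtype.ext (hstar a)
    have hfstar (t) : f (star (R t)) = star (f (R t)) := by
      induction t using FreeAlgebra.induction with
      | grade0 r => rw [AlgHom.commutes, ← algebraMap_star_comm, AlgHom.commutes,
          AlgHom.commutes, algebraMap_star_comm]
      | grade1 a => rw [hRι, ← hsstar, hfs, hfs, hψ.map_star]
      | mul a b ha hb => rw [map_mul, star_mul, map_mul, map_mul, ha, hb, star_mul]
      | add a b ha hb => rw [map_add, star_add, map_add, map_add, ha, hb, star_add]
    let F : P →⋆ₐ[ℂ] D :=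
      { f with
        map_star' := fun x => by obtain ⟨t, rfl⟩ := hsurj x; exact hfstar t }
    refine ⟨F, ⟨isDeterministic_of_norm_le F fun x => ?_, LinearMap.ext hfs⟩, ?_⟩
    · obtain ⟨t, rfl⟩ := hsurj x
      exact (congrArg norm (hf t)).trans_le (hle t)
    · rintro g ⟨hg, hgs⟩
      ext x
      obtain ⟨t, rfl⟩ := hsurj x
      change g (R t) = f (R t)
      induction t using FreeAlgebra.induction with
      | grade0 r =>
        rw [AlgHom.commutes, AlgHom.commutes, Algebra.algebraMap_eq_smul_one, map_smul, hg.map_one,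
          Algebra.algebraMap_eq_smul_one]
      | grade1 a => rw [hRι, hfs, ← hgs]; rfl
      | mul a b ha hb => rw [map_mul, hg.map_mul, map_mul, ha, hb]
      | add a b ha hb => rw [map_add, map_add, map_add, ha, hb]
  · ext i
    exact hcl (B i) (hK i) _ _

/-! ### Cutoffs and quotients by closed ideals -/

section

variable {C : Type*} [CStarAlgebra C]

/-- For a self-adjoint `y` there is a self-adjoint contraction `u` which cuts `y` down to a small
element, with `1 - u` in the right ideal generated by `y ^ 2`. -/
theorem exists_cutoff {y : C} (hy : IsSelfAdjoint y) {ε : ℝ} (hε : 0 < ε) :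
    ∃ u c : C, IsSelfAdjoint u ∧ ‖u‖ ≤ 1 ∧ ‖u * y * u‖ ≤ ε ∧ 1 - u = y * y * c := by
  -- With `u = f(y)`, `1 - f(t) = t² · ε⁻² f(t)`, while `|t| f(t)² ≤ ε`.
  let f : ℝ → ℝ := fun t => ε ^ 2 / (ε ^ 2 + t ^ 2)
  have hpos (t : ℝ) : 0 < ε ^ 2 + t ^ 2 := by positivity
  have hf : Continuous f := by
    fun_prop (disch := exact fun t => (hpos t).ne')
  refine ⟨cfc f y, (ε ^ 2)⁻¹ • cfc f y, cfc_predicate f y, ?_, ?_, ?_⟩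
  · refine norm_cfc_le zero_le_one fun t _ => ?_
    rw [Real.norm_of_nonneg (by positivity)]
    exact div_le_one_of_le₀ (by nlinarith [sq_nonneg t]) (hpos t).le
  · have : cfc f y * y * cfc f y = cfc (fun t => f t * t * f t) y := by
      rw [cfc_mul (fun t => f t * t) f y, cfc_mul f (fun t => t) y, cfc_id' ℝ y]
    rw [this]
    refine norm_cfc_le hε.le fun t _ => ?_
    have h1 : f t * t * f t = ε * (ε ^ 3 * t / (ε ^ 2 + t ^ 2) ^ 2) := by
      simp only [f]; field_simp
    rw [h1, norm_mul, Real.norm_of_nonneg hε.le]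
    refine mul_le_of_le_one_right hε.le ?_
    rw [Real.norm_eq_abs, abs_div, abs_of_pos (by positivity : 0 < (ε ^ 2 + t ^ 2) ^ 2),
      div_le_one (by positivity), abs_le]
    constructor <;> nlinarith [sq_nonneg (ε * t), sq_nonneg (t ^ 2), sq_nonneg (ε ^ 2),
      mul_nonneg (sq_nonneg ε) (sq_nonneg (ε - t)), mul_nonneg (sq_nonneg ε) (sq_nonneg (ε + t))]
  · have : y * y * ((ε ^ 2)⁻¹ • cfc f y) = cfc (fun t => t * t * ((ε ^ 2)⁻¹ • f t)) y := by
      rw [cfc_mul (fun t => t * t) (fun t => (ε ^ 2)⁻¹ • f t) y, cfc_mul (fun t => t) (fun t => t) y,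
        cfc_id' ℝ y, cfc_smul _ f y]
    rw [this, ← cfc_one ℝ y, ← cfc_sub (1 : ℝ → ℝ) f y]
    refine cfc_congr fun t _ => ?_
    have := (hpos t).ne'
    simp only [f, Pi.one_apply, smul_eq_mul]
    field_simp
    ring

end

section Quotient

variable {A : Type*} [PreCStarAlgebra A]

/-- The C*-inequality for the quotient norm modulo a two-sided `*`-ideal. -/
theorem infDist_sq_le (I : Ideal A) [I.IsTwoSided] (hI : ∀ x ∈ I, star x ∈ I) (x : A) :
    Metric.infDist x (I : Set A) ^ 2 ≤ Metric.infDist (star x * x) (I : Set A) := by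
  refine (Metric.le_infDist ⟨0, I.zero_mem⟩).2 fun {y} hy => le_of_forall_pos_le_add fun ε hε => ?_
  -- Replacing `y` by its real part stays in `I` and does not increase the distance to `star x * x`.
  let y' : A := (2⁻¹ : ℂ) • (y + star y)
  have hy' : y' ∈ I := Submodule.smul_of_tower_mem I _ (I.add_mem hy (hI y hy))
  have hy's : star y' = y' := by
    simp [y', add_comm]
  have hdist : ‖star x * x - y'‖ ≤ dist (star x * x) y := by
    have h : star x * x - y' = (2⁻¹ : ℂ) • ((star x * x - y) + star (star x * x - y)) := by
      simp only [y', star_sub, star_mul, star_star]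
      module
    rw [h, norm_smul, dist_eq_norm]
    have := norm_add_le (star x * x - y) (star (star x * x - y))
    rw [norm_star] at this
    rw [show ‖(2⁻¹ : ℂ)‖ = 2⁻¹ by norm_num]
    linarith
  have hsa : IsSelfAdjoint (y' : Completion A) := by rw [isSelfAdjoint_iff, ← coe_star, hy's]
  obtain ⟨u, c, hu, hu1, huy, huc⟩ := exists_cutoff hsa hε
  have hxu : ‖(x : Completion A) * u‖ ^ 2 ≤ dist (star x * x) y + ε := by
    have h : star ((x : Completion A) * u) * (x * u) =
        u * (star x * x - y' : A) * u + u * y' * u := by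
      rw [star_mul, hu.star_eq, Completion.coe_sub, Completion.coe_mul, coe_star]
      noncomm_ring
    rw [sq, ← CStarRing.norm_star_mul_self, h]
    refine (norm_add_le _ _).trans (add_le_add (le_trans ?_ hdist) huy)
    rw [← Completion.norm_coe (star x * x - y')]
    calc _ ≤ ‖u‖ * ‖((star x * x - y' : A) : Completion A)‖ * ‖u‖ :=
          (norm_mul_le _ _).trans (mul_le_mul_of_nonneg_right (norm_mul_le _ _) (norm_nonneg _))
      _ ≤ 1 * ‖((star x * x - y' : A) : Completion A)‖ * 1 := by gcongr
      _ = _ := by ring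
  have hle : Metric.infDist x (I : Set A) ≤ ‖(x : Completion A) * u‖ := by
    -- `x * u = x - x * (y' * y' * c)` with `c` only in the completion. For `c` in `A` the
    -- subtracted term lies in `I`; density does the rest.
    have hclosed : IsClosed {c : Completion A |
        Metric.infDist x (I : Set A) ≤ ‖(x : Completion A) - x * (y' * y' * c)‖} :=
      isClosed_le continuous_const (by fun_prop)
    have hall (c : Completion A) :
        Metric.infDist x (I : Set A) ≤ ‖(x : Completion A) - x * (y' * y' * c)‖ := by
      induction c using Completion.induction_on with
      | hp => exact hclosed
      | ih p =>
        rw [← Completion.coe_mul, ← Completion.coe_mul, ← Completion.coe_mul,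
          ← Completion.coe_sub, Completion.norm_coe, ← dist_eq_norm]
        exact Metric.infDist_le_dist_of_mem
          (I.mul_mem_left _ (I.mul_mem_right _ (I.mul_mem_left _ hy')))
    have := hall c
    rwa [← huc, mul_sub, mul_one, sub_sub_cancel] at this
  exact (pow_le_pow_left₀ Metric.infDist_nonneg hle 2).trans hxu

/-- The quotient of a pre-C*-algebra by a closed two-sided `*`-ideal. -/
theorem exists_quotient {A : Type u} [PreCStarAlgebra A] (I : Ideal A) [I.IsTwoSided]
    (hI : ∀ x ∈ I, star x ∈ I) (hc : IsClosed (I : Set A)) :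
    ∃ (Q : Type u) (_ : PreCStarAlgebra Q) (π : A →⋆ₐ[ℂ] Q), Function.Surjective π ∧
      ∀ x, ‖π x‖ = Metric.infDist x (I : Set A) := by
  let nacg : NormedAddCommGroup (A ⧸ I) := Submodule.Quotient.normedAddCommGroup I
  have hnorm (x : A) : ‖Ideal.Quotient.mk I x‖ = Metric.infDist x (I : Set A) :=
    QuotientAddGroup.norm_mk (S := I.toAddSubgroup) x
  have hlt (x : A ⧸ I) {ε : ℝ} (hε : 0 < ε) :
      ∃ a, Ideal.Quotient.mk I a = x ∧ ‖a‖ < ‖x‖ + ε :=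
    QuotientAddGroup.exists_norm_mk_lt (S := I.toAddSubgroup) x hε
  have hmk (a : A) : ‖Ideal.Quotient.mk I a‖ ≤ ‖a‖ :=
    QuotientAddGroup.norm_mk_le_norm (S := I.toAddSubgroup)
  let nring : NormedRing (A ⧸ I) :=
    { nacg, (inferInstance : Ring (A ⧸ I)) with
      norm_mul_le := fun x y => by
        have key {ε : ℝ} (hε : 0 < ε) : ‖x * y‖ ≤ (‖x‖ + ε) * (‖y‖ + ε) := by
          obtain ⟨a, rfl, ha⟩ := hlt x hε
          obtain ⟨b, rfl, hb⟩ := hlt y hε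
          rw [← map_mul]
          exact (hmk _).trans ((norm_mul_le _ _).trans (by gcongr))
        have hcont : Continuous fun ε : ℝ => (‖x‖ + ε) * (‖y‖ + ε) := by fun_prop
        have := hcont.tendsto' 0 (‖x‖ * ‖y‖) (by simp)
        exact ge_of_tendsto (this.mono_left (nhdsWithin_le_nhds (s := Set.Ioi 0)))
          (Filter.eventually_of_mem self_mem_nhdsWithin fun ε hε => key hε) }
  let str : StarRing (A ⧸ I) :=
    { star := Quotient.map' star fun a b h => by
        rw [Submodule.quotientRel_def] at h ⊢
        simpa using hI _ h
      star_involutive := by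
        rintro ⟨a⟩
        exact congrArg (Ideal.Quotient.mk I) (star_star a)
      star_mul := by
        rintro ⟨a⟩ ⟨b⟩
        exact congrArg (Ideal.Quotient.mk I) (star_mul a b)
      star_add := by
        rintro ⟨a⟩ ⟨b⟩
        exact congrArg (Ideal.Quotient.mk I) (star_add a b) }
  let alg : NormedAlgebra ℂ (A ⧸ I) :=
    { (Ideal.Quotient.algebra ℂ : Algebra ℂ (A ⧸ I)) with
      norm_smul_le := fun c x => by
        refine le_of_forall_pos_le_add fun ε hε => ?_
        -- The `+ 1` allows `c = 0`.
        obtain ⟨a, rfl, ha⟩ := hlt x (div_pos hε (by positivity : 0 < ‖c‖ + 1))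
        calc ‖Ideal.Quotient.mk I (c • a)‖ ≤ ‖c‖ * ‖a‖ := (hmk _).trans (norm_smul_le c a)
          _ ≤ ‖c‖ * (‖Ideal.Quotient.mk I a‖ + ε / (‖c‖ + 1)) := by gcongr
          _ ≤ _ := by
            rw [mul_add]
            gcongr
            rw [mul_div_assoc', div_le_iff₀ (by positivity)]
            nlinarith [norm_nonneg c] }
  let inst : PreCStarAlgebra (A ⧸ I) :=
    { nring, str, alg with
      norm_mul_self_le := by
        rintro ⟨a⟩
        change ‖Ideal.Quotient.mk I a‖ * ‖Ideal.Quotient.mk I a‖ ≤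
          ‖Ideal.Quotient.mk I (star a * a)‖
        rw [hnorm, hnorm, ← sq]
        exact infDist_sq_le I hI a
      star_smul := by
        rintro c ⟨a⟩
        exact congrArg (Ideal.Quotient.mk I) (star_smul c a) }
  exact ⟨A ⧸ I, inst, { Ideal.Quotient.mk I with
                        commutes' := fun _ => rfl
                        map_star' := fun _ => rfl }, Ideal.Quotient.mk_surjective, hnorm⟩

end Quotient

/-! ### The commutator ideal and abelianization -/

section

variable (P : Type u) [PreCStarAlgebra P]

/-- `commutatorIdeal` as a left ideal. -/
def commutatorLeftIdeal : Ideal P :=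
  (TwoSidedIdeal.span {c : P | ∃ x y : P, c = x * y - y * x}).asIdeal.closure

theorem coe_commutatorLeftIdeal : (commutatorLeftIdeal P : Set P) = commutatorIdeal P := rfl

instance : (commutatorLeftIdeal P).IsTwoSided where
  mul_mem_of_left b ha :=
    map_mem_closure (f := (· * b)) (continuous_mul_const b) ha fun _ hx =>
      TwoSidedIdeal.mul_mem_right _ _ _ hx

variable {P}

theorem star_mem_commutatorLeftIdeal {x : P} (hx : x ∈ commutatorLeftIdeal P) :
    star x ∈ commutatorLeftIdeal P := by
  refine map_mem_closure continuous_star hx fun x hx => ?_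
  rw [SetLike.mem_coe, TwoSidedIdeal.mem_asIdeal] at hx ⊢
  induction hx using TwoSidedIdeal.span_induction with
  | mem x h =>
    obtain ⟨a, b, rfl⟩ := h
    exact TwoSidedIdeal.subset_span ⟨star b, star a, by simp⟩
  | zero => simp
  | add x y _ _ hx hy => rw [star_add]; exact add_mem hx hy
  | neg x _ hx => rw [star_neg]; exact neg_mem hx
  | left_absorb a x _ hx => rw [star_mul]; exact TwoSidedIdeal.mul_mem_right _ _ _ hx
  | right_absorb a x _ hx => rw [star_mul]; exact TwoSidedIdeal.mul_mem_left _ _ _ hx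

theorem IsDeterministic.map_eq_zero_of_mem_commutatorIdeal {B : Type*} [PreCStarAlgebra B]
    (hB : IsClassical B) {q : P →ₗ[ℂ] B} (hq : IsDeterministic q) {x : P}
    (hx : x ∈ commutatorIdeal P) : q x = 0 := by
  have hcont : Continuous q :=
    AddMonoidHomClass.continuous_of_bound q 1 (by simpa using hq.norm_map_le)
  refine closure_minimal (fun x hx => ?_) (isClosed_singleton.preimage hcont) hx
  rw [Set.mem_preimage, Set.mem_singleton_iff]
  induction hx using TwoSidedIdeal.span_induction with
  | mem x h =>
    obtain ⟨a, b, rfl⟩ := h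
    rw [map_sub, hq.map_mul, hq.map_mul, hB, sub_self]
  | zero => exact map_zero q
  | add x y _ _ hx hy => rw [map_add, hx, hy, add_zero]
  | neg x _ hx => rw [map_neg, hx, neg_zero]
  | left_absorb a x _ hx => rw [hq.map_mul, hx, mul_zero]
  | right_absorb a x _ hx => rw [hq.map_mul, hx, zero_mul]

theorem IsDeterministic.norm_map_le_infDist {B : Type*} [PreCStarAlgebra B]
    (hB : IsClassical B) {q : P →ₗ[ℂ] B} (hq : IsDeterministic q) (x : P) :
    ‖q x‖ ≤ Metric.infDist x (commutatorIdeal P) := by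
  refine (Metric.le_infDist ⟨0, (commutatorLeftIdeal P).zero_mem⟩).2 fun {y} hy => ?_
  have := hq.norm_map_le (x - y)
  rwa [map_sub, hq.map_eq_zero_of_mem_commutatorIdeal hB hy, sub_zero, ← dist_eq_norm] at this

theorem mem_commutatorIdeal_iff (x : P) :
    x ∈ commutatorIdeal P ↔ Metric.infDist x (commutatorIdeal P) = 0 :=
  isClosed_closure.mem_iff_infDist_zero ⟨0, (commutatorLeftIdeal P).zero_mem⟩

/-- A deterministic map into a classical object through which every deterministic map into a
classical object factors uniquely is the abelianization. -/
theorem isAbelianization_of_existsUnique {S : Type u} [PreCStarAlgebra S] (hS : IsClassical S)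
    {q : P →ₗ[ℂ] S} (hq : IsDeterministic q)
    (huniv : ∀ (B : Type u) [PreCStarAlgebra B], IsClassical B →
      ∀ g : P →ₗ[ℂ] B, IsDeterministic g → ∃! f : S →ₗ[ℂ] B, IsDeterministic f ∧ f ∘ₗ q = g) :
    IsAbelianization q := by
  obtain ⟨Q, _, π, hπ, hnorm⟩ := exists_quotient (commutatorLeftIdeal P)
    (fun _ => star_mem_commutatorLeftIdeal) isClosed_closure
  rw [coe_commutatorLeftIdeal] at hnorm
  have hπdet : IsDeterministic (π : P →ₗ[ℂ] Q) := isDeterministic_of_norm_le π fun x => by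
    rw [hnorm]
    exact (Metric.infDist_le_dist_of_mem (commutatorLeftIdeal P).zero_mem).trans_eq
      (dist_zero_right x)
  have hQ : IsClassical Q := fun a b => by
    obtain ⟨x, rfl⟩ := hπ a
    obtain ⟨y, rfl⟩ := hπ b
    rw [← sub_eq_zero, ← map_mul, ← map_mul, ← map_sub, ← norm_eq_zero, hnorm,
      ← mem_commutatorIdeal_iff]
    exact subset_closure (TwoSidedIdeal.subset_span ⟨x, y, rfl⟩)
  obtain ⟨f, ⟨hf, hfq⟩, -⟩ := huniv Q hQ _ hπdet
  have hfq' (x : P) : f (q x) = π x := LinearMap.congr_fun hfq x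
  have hle (x : P) : ‖q x‖ ≤ ‖π x‖ := (hnorm x).symm ▸ hq.norm_map_le_infDist hS x
  let qA : P →ₐ[ℂ] S := AlgHom.ofLinearMap q hq.map_one hq.map_mul
  -- In the other direction, `q` kills the ideal and is contractive, so it factors through the
  -- quotient.
  obtain ⟨g, hg⟩ := exists_lift_of_norm_le π.toAlgHom hπ qA hle
  have hg' (x : P) : g (π x) = q x := hg x
  let G : Q →⋆ₐ[ℂ] S :=
    { g with
      map_star' := fun a => by
        obtain ⟨x, rfl⟩ := hπ a
        change g (star (π x)) = star (g (π x))
        rw [← map_star, hg', hg', hq.map_star] }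
  have hG : IsDeterministic (G : Q →ₗ[ℂ] S) := isDeterministic_of_norm_le G fun a => by
    obtain ⟨x, rfl⟩ := hπ a
    exact (congrArg norm (hg' x)).trans_le (hle x)
  -- Both sides factor `q` through itself, so uniqueness identifies them; this yields surjectivity
  -- of `q`.
  have hGf : (G : Q →ₗ[ℂ] S) ∘ₗ f = LinearMap.id :=
    (huniv S hS q hq).unique
      ⟨hG.comp hf, LinearMap.ext fun x => (congrArg g (hfq' x)).trans (hg' x)⟩
      ⟨isDeterministic_of_norm_le (StarAlgHom.id ℂ S) fun _ => le_rfl, LinearMap.id_comp q⟩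
  have heq (x : P) : ‖q x‖ = Metric.infDist x (commutatorIdeal P) := by
    refine le_antisymm (hq.norm_map_le_infDist hS x) ?_
    -- `π = f ∘ q` with `f` contractive.
    rw [← hnorm, ← hfq']
    exact hf.norm_map_le _
  exact
    { map_one := hq.map_one
      map_mul := hq.map_mul
      map_star := hq.map_star
      surjective := fun s => by
        obtain ⟨x, hx⟩ := hπ (f s)
        exact ⟨x, by rw [← hg', hx]; exact LinearMap.congr_fun hGf s⟩
      ker_eq := fun x => by rw [← norm_eq_zero, heq, mem_commutatorIdeal_iff]
      norm_eq := heq }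

end

end PreCStarAlgebra

theorem corollary4p13 (A : Type u) [PreCStarAlgebra A] :
    (∃ (P : Type u) (_ : PreCStarAlgebra P) (samp : A →ₗ[ℂ] P),
      PreCStarAlgebra.IsDistributionObject samp) ∧
    (∃ (S : Type u) (_ : PreCStarAlgebra S) (ev : A →ₗ[ℂ] S),
      PreCStarAlgebra.IsStateSpaceObject ev) ∧
    ∀ (P S : Type u) [PreCStarAlgebra P] [PreCStarAlgebra S]
      (samp : A →ₗ[ℂ] P) (ev : A →ₗ[ℂ] S),
      PreCStarAlgebra.IsDistributionObject samp → PreCStarAlgebra.IsStateSpaceObject ev →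
      ∃ evSharp : P →ₗ[ℂ] S,
        PreCStarAlgebra.IsDeterministic evSharp ∧ evSharp ∘ₗ samp = ev ∧
        PreCStarAlgebra.IsAbelianization evSharp ∧
        ∀ (B : Type u) [PreCStarAlgebra B], PreCStarAlgebra.IsClassical B →
          ∀ g : P →ₗ[ℂ] B, PreCStarAlgebra.IsDeterministic g →
            ∃! f : S →ₗ[ℂ] B, PreCStarAlgebra.IsDeterministic f ∧ f ∘ₗ evSharp = g := by
  refine ⟨?_, ?_, fun P S _ _ samp ev hP hS => ?_⟩
  · obtain ⟨P, _, samp, hsamp, huniv, -⟩ :=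
      PreCStarAlgebra.exists_universal A (fun _ _ => True)
    exact ⟨P, _, samp, hsamp, fun B _ => huniv B trivial⟩
  · obtain ⟨S, _, ev, hev, huniv, hcl⟩ :=
      PreCStarAlgebra.exists_universal A (fun B _ => PreCStarAlgebra.IsClassical B)
    exact ⟨S, _, ev, hcl fun _ _ h => h, hev, huniv⟩
  · obtain ⟨q, ⟨hq, hqs⟩, -⟩ := hP.existsUnique S ev hS.isCPU
    have huniv : ∀ (B : Type u) [PreCStarAlgebra B], PreCStarAlgebra.IsClassical B →
        ∀ g : P →ₗ[ℂ] B, PreCStarAlgebra.IsDeterministic g →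
          ∃! f : S →ₗ[ℂ] B, PreCStarAlgebra.IsDeterministic f ∧ f ∘ₗ q = g := by
      intro B _ hB g hg
      have hgs := hg.toIsCPU.comp hP.isCPU
      obtain ⟨f, ⟨hf, hfe⟩, huniq⟩ := hS.existsUnique B hB _ hgs
      refine ⟨f, ⟨hf, ?_⟩, fun f' hf' => huniq f' ⟨hf'.1, ?_⟩⟩
      -- Deterministic maps out of `P` are determined by their composites with `samp`.
      · refine (hP.existsUnique B _ hgs).unique ⟨hf.comp hq, ?_⟩ ⟨hg, rfl⟩
        rw [LinearMap.comp_assoc, hqs, hfe]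
      · rw [← hf'.2, LinearMap.comp_assoc, hqs]
    exact ⟨q, hq, hqs,
      PreCStarAlgebra.isAbelianization_of_existsUnique hS.isClassical hq huniv, huniv⟩
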